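/- Let $a,b,c\in\mathbb R$ and let $p,q,i,j,k,l$ be nonnegative integers. Then the planar polynomial differential system \[ \dot x=a\,x^p y^q,\qquad \dot y=b\,x^i y^j+c\,x^k y^l \] on $\mathbb R^2$ has no limit cycle. Here $x^0=y^0=1$; a periodic orbit is the trace in $\mathbb R^2$ of a nonconstant periodic solution; and a limit cycle is a periodic orbit that is isolated in the set of all periodic orbits of the system, i.e. that has a neighbourhood containing no other periodic orbit. -/

import Mathlib

/-- `Γ` is a periodic orbit of the autonomous planar system `z' = X z`: the trace of a
nonconstant solution, defined for all times, which has some period `T > 0`. -/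
def IsPeriodicOrbit (X : ℝ × ℝ → ℝ × ℝ) (Γ : Set (ℝ × ℝ)) : Prop :=
  ∃ (γ : ℝ → ℝ × ℝ) (T : ℝ), 0 < T ∧ IsIntegralCurve γ (fun _ z => X z) ∧
    Function.Periodic γ T ∧ (∃ t, γ t ≠ γ 0) ∧ Set.range γ = Γ

/-- `Γ` is a limit cycle of `z' = X z`: a periodic orbit that is isolated in the set of all
periodic orbits, that is, some neighbourhood of `Γ` contains no other periodic orbit. -/
def IsLimitCycle (X : ℝ × ℝ → ℝ × ℝ) (Γ : Set (ℝ × ℝ)) : Prop :=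
  IsPeriodicOrbit X Γ ∧
    ∃ U : Set (ℝ × ℝ), IsOpen U ∧ Γ ⊆ U ∧
      ∀ Γ' : Set (ℝ × ℝ), IsPeriodicOrbit X Γ' → Γ' ⊆ U → Γ' = Γ

/-! Take a nonconstant periodic solution. If `y ^ q` kept one sign, so would `x'`, because `x`
vanishes identically or nowhere when `p ≠ 0`. Then `x` would be constant and `y` would solve a
scalar autonomous equation, hence be constant too. So `q` is odd and `y` has a zero. By uniqueness
for linear equations, some monomial of `y'` is free of `y`; by symmetry let `j = 0`.

If `l` is even, or `c = 0`, the reflection `y ↦ -y` reverses time. If `l` is odd, an integrating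
factor shows that `x ^ i` changes sign, so `i` is odd, `x` has a zero and `p = 0`. For even `k`, a
one-signed energy derivative then forces constancy; for odd `k`, the reflection `x ↦ -x` reverses
time.

In the reversible cases (`not_isLimitCycle_of_reversible`) the orbit meets the axis again,
transversally, half a period later. Solutions starting on the axis nearby also return to it, and
symmetry closes them up, so the orbit is not isolated. -/

/-! ### Integral curves and reversing symmetries -/

open Set Metric Filter Topology in
/-- A bounded, globally Lipschitz vector field has global integral curves. -/
theorem exists_isIntegralCurve_of_lipschitzWith_of_bounded {E : Type*} [NormedAddCommGroup E]
    [NormedSpace ℝ E] [CompleteSpace E] {v : E → E} {K : NNReal} {C : ℝ}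
    (hK : LipschitzWith K v) (hC : ∀ x, ‖v x‖ ≤ C) (x : E) :
    ∃ γ : ℝ → E, γ 0 = x ∧ IsIntegralCurve γ (fun _ => v) := by
  have hC0 : 0 ≤ C := (norm_nonneg _).trans (hC x)
  have key : ∀ A : ℝ, ∃ γ : ℝ → E, 0 < A → γ 0 = x ∧ ∀ t ∈ Ioo (-A) A, HasDerivAt γ (v (γ t)) t := by
    intro A
    by_cases hA : 0 < A
    swap
    · exact ⟨fun _ => x, fun h => absurd h hA⟩
    have hp : IsPicardLindelof (fun _ => v) (tmin := -A) (tmax := A)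
        ⟨0, by constructor <;> linarith⟩ x ⟨C * A, by positivity⟩ 0 ⟨C, hC0⟩ K :=
      IsPicardLindelof.of_time_independent (fun y _ => hC y) hK.lipschitzOnWith
        (by simp only [sub_zero, zero_sub, neg_neg, max_self, NNReal.coe_zero]; exact le_rfl)
    obtain ⟨γ, h0, h⟩ := hp.exists_eq_forall_mem_Icc_hasDerivWithinAt₀
    exact ⟨γ, fun _ => ⟨h0, fun t ht =>
      (h t (Ioo_subset_Icc_self ht)).hasDerivAt (Icc_mem_nhds ht.1 ht.2)⟩⟩
  choose γ hγ using key
  have agree : ∀ A B : ℝ, 0 < A → A ≤ B → EqOn (γ A) (γ B) (Ioo (-A) A) := by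
    intro A B hA hAB
    have hB : 0 < B := hA.trans_le hAB
    refine ODE_solution_unique_of_mem_Ioo (v := fun _ => v) (s := fun _ => univ) (K := K)
      (fun _ _ => hK.lipschitzOnWith) (t₀ := 0) ⟨by linarith, hA⟩
      (fun t ht => ⟨(hγ A hA).2 t ht, trivial⟩)
      (fun t ht => ⟨(hγ B hB).2 t ⟨by linarith [ht.1], by linarith [ht.2]⟩, trivial⟩) ?_
    rw [(hγ A hA).1, (hγ B hB).1]
  -- Glue the local solutions: at time `t`, use the one on the interval of radius `|t| + 1`.
  refine ⟨fun t => γ (|t| + 1) t, by simpa using (hγ 1 one_pos).1, fun t => ?_⟩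
  have hpos : 0 < |t| + 2 := by positivity
  have ht : t ∈ Ioo (-(|t| + 2)) (|t| + 2) :=
    ⟨by linarith [neg_abs_le t], by linarith [le_abs_self t]⟩
  have heq : ∀ s ∈ Ioo (-(|t| + 1)) (|t| + 1), γ (|s| + 1) s = γ (|t| + 2) s := by
    intro s hs
    have hs' : |s| < |t| + 1 := abs_lt.2 hs
    exact agree _ _ (by positivity) (by linarith)
      ⟨by linarith [neg_abs_le s], by linarith [le_abs_self s]⟩
  have ht1 : t ∈ Ioo (-(|t| + 1)) (|t| + 1) :=
    ⟨by linarith [neg_abs_le t], by linarith [le_abs_self t]⟩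
  have hd := (hγ _ hpos).2 t ht
  simp only
  rw [heq t ht1]
  exact hd.congr_of_eventuallyEq (eventually_of_mem (Ioo_mem_nhds ht1.1 ht1.2) heq)

open Set Metric Filter Topology in
/-- The zeros of a real function with nonvanishing derivative at each zero are countable. -/
theorem countable_zeros_of_hasDerivAt {f f' : ℝ → ℝ} (hf : ∀ t, HasDerivAt f (f' t) t)
    (h0 : ∀ t, f t = 0 → f' t ≠ 0) : {t | f t = 0}.Countable := by
  have : DiscreteTopology {t | f t = 0} := by
    rw [discreteTopology_subtype_iff]
    intro t ht
    rw [← disjoint_iff, Filter.disjoint_principal_right]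
    exact (hf t).eventually_ne (h0 t ht)
  exact (TopologicalSpace.separableSpace_iff_countable (α := {t | f t = 0})).1 inferInstance

open Set Metric Filter Topology in
/-- A function with nonzero derivative at a zero changes sign there. -/
theorem exists_sign_change_of_hasDerivAt {f : ℝ → ℝ} {d t₀ : ℝ} (hf : HasDerivAt f d t₀)
    (hd : 0 < d) (h0 : f t₀ = 0) {ε : ℝ} (hε : 0 < ε) :
    ∃ t₁ ∈ Ioo (t₀ - ε) t₀, ∃ t₂ ∈ Ioo t₀ (t₀ + ε), f t₁ < 0 ∧ 0 < f t₂ := by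
  have hs := (hasDerivAt_iff_tendsto_slope.1 hf).eventually (lt_mem_nhds hd)
  have hl : ∀ᶠ t in 𝓝[<] t₀, 0 < slope f t₀ t := hs.filter_mono (nhdsWithin_mono _ fun t ht => ne_of_lt ht)
  have hr : ∀ᶠ t in 𝓝[>] t₀, 0 < slope f t₀ t := hs.filter_mono (nhdsWithin_mono _ fun t ht => ne_of_gt ht)
  obtain ⟨t₁, h₁, m₁⟩ := (hl.and (Ioo_mem_nhdsLT (show t₀ - ε < t₀ by linarith))).exists
  obtain ⟨t₂, h₂, m₂⟩ := (hr.and (Ioo_mem_nhdsGT (show t₀ < t₀ + ε by linarith))).exists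
  refine ⟨t₁, m₁, t₂, m₂, ?_, ?_⟩
  · rw [slope_def_field, h0, sub_zero] at h₁
    by_contra! h
    exact absurd h₁ (not_lt.2 (div_nonpos_of_nonneg_of_nonpos h (by linarith [m₁.2])))
  · rw [slope_def_field, h0, sub_zero] at h₂
    by_contra! h
    exact absurd h₂ (not_lt.2 (div_nonpos_of_nonpos_of_nonneg h (by linarith [m₂.1])))

open Set in
/-- Two global integral curves of a Lipschitz field which meet at one time coincide. -/
theorem IsIntegralCurve.eq_of_lipschitzWith {E : Type*} [NormedAddCommGroup E] [NormedSpace ℝ E]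
    {v : E → E} {K : NNReal} (hK : LipschitzWith K v) {γ δ : ℝ → E}
    (hγ : IsIntegralCurve γ (fun _ => v)) (hδ : IsIntegralCurve δ (fun _ => v)) {t₀ : ℝ}
    (h : γ t₀ = δ t₀) : γ = δ :=
  ODE_solution_unique_univ (v := fun _ => v) (s := fun _ => univ) (fun _ => hK.lipschitzOnWith)
    (fun t => ⟨hγ t, trivial⟩) (fun t => ⟨hδ t, trivial⟩) h

/-- Translating time in an integral curve of an autonomous field. -/
theorem IsIntegralCurve.comp_add_right {E : Type*} [NormedAddCommGroup E] [NormedSpace ℝ E]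
    {v : E → E} {γ : ℝ → E} (hγ : IsIntegralCurve γ (fun _ => v)) (s : ℝ) :
    IsIntegralCurve (fun t => γ (t + s)) (fun _ => v) :=
  fun t => (hγ (t + s)).comp_add_const t s

/-- A time-reversing symmetry maps integral curves to integral curves with reversed time. -/
theorem IsIntegralCurve.comp_neg_of_reversible {E : Type*} [NormedAddCommGroup E]
    [NormedSpace ℝ E] {v : E → E} {R : E →L[ℝ] E} (hR : ∀ z, v (R z) = -R (v z)) {γ : ℝ → E}
    (hγ : IsIntegralCurve γ (fun _ => v)) :
    IsIntegralCurve (fun t => R (γ (-t))) (fun _ => v) := by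
  intro t
  have h := (hγ (-t)).scomp t (hasDerivAt_neg t)
  have h2 := R.hasFDerivAt.comp_hasDerivAt t h
  have h3 : R ((-1 : ℝ) • v (γ (-t))) = v (R (γ (-t))) := by rw [hR]; simp
  exact h2.congr_deriv h3

/-- A `C¹` field with a norm-preserving reversing symmetry `R` can be modified outside a ball to a bounded,
Lipschitz field with the same symmetry. -/
theorem exists_reversible_cutoff {E : Type*} [NormedAddCommGroup E] [NormedSpace ℝ E]
    [FiniteDimensional ℝ E] {X : E → E} (hX : ContDiff ℝ 1 X) {R : E →L[ℝ] E}
    (hRn : ∀ z, ‖R z‖ = ‖z‖) (hRR : ∀ z, R (R z) = z) (hrev : ∀ z, X (R z) = -R (X z)) (M : ℝ) :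
    ∃ (Y : E → E) (K : NNReal) (C : ℝ), LipschitzWith K Y ∧ (∀ z, ‖Y z‖ ≤ C) ∧
      (∀ z, Y (R z) = -R (Y z)) ∧ ∀ z, ‖z‖ < M → Y z = X z := by
  let χ : ContDiffBump (0 : E) := ⟨|M| + 1, |M| + 2, by positivity, by linarith⟩
  have hχR : ContDiff ℝ 1 fun z => χ (R z) := χ.contDiff.comp R.contDiff
  -- The product of the bump function with its reflection is `R`-invariant, so the cutoff keeps the
  -- symmetry.
  have hY : ContDiff ℝ 1 fun z => (χ z * χ (R z)) • X z := (χ.contDiff.mul hχR).smul hX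
  have hc : HasCompactSupport fun z => (χ z * χ (R z)) • X z :=
    HasCompactSupport.smul_right (HasCompactSupport.mul_right χ.hasCompactSupport)
  obtain ⟨K, hK⟩ := ContDiff.lipschitzWith_of_hasCompactSupport hc hY one_ne_zero
  obtain ⟨C, hC⟩ := hc.exists_bound_of_continuous hY.continuous
  refine ⟨_, K, C, hK, hC, fun z => ?_, fun z hz => ?_⟩
  · simp only [hRR, hrev, map_smul, smul_neg, mul_comm]
  · have h1 : χ z = 1 := χ.one_of_mem_closedBall (by
      simpa [χ] using by linarith [le_abs_self M])
    have h2 : χ (R z) = 1 := χ.one_of_mem_closedBall (by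
      simpa [χ, hRn] using by linarith [le_abs_self M])
    simp [h1, h2]

/-! ### Periodic orbits of reversible fields are not isolated -/

open Set Metric Filter Topology in
/-- A periodic orbit of a reversible planar field which meets the axis of the symmetry is not
isolated, since it is surrounded by symmetric periodic orbits. -/
theorem not_isLimitCycle_of_reversible {X : ℝ × ℝ → ℝ × ℝ} (hX : ContDiff ℝ 1 X)
    {R : ℝ × ℝ →L[ℝ] ℝ × ℝ} (hRn : ∀ z, ‖R z‖ = ‖z‖) (hRR : ∀ z, R (R z) = z)
    (hrev : ∀ z, X (R z) = -R (X z)) {ℓ : ℝ × ℝ →L[ℝ] ℝ} (hfix : ∀ z, ℓ z = 0 ↔ R z = z)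
    {e : ℝ × ℝ} (he : e ≠ 0) (hℓe : ℓ e = 0) {Γ : Set (ℝ × ℝ)} (hmeet : ∃ z ∈ Γ, ℓ z = 0) :
    ¬ IsLimitCycle X Γ := by
  rintro ⟨⟨γ₀, T, hT, hγ₀, hper₀, ⟨t', ht'⟩, rfl⟩, U, hU, hΓU, hiso⟩
  obtain ⟨_, ⟨t₀, rfl⟩, hz⟩ := hmeet
  obtain ⟨γ, hγ, hper, hrange, hℓ0, hnc⟩ : ∃ γ : ℝ → ℝ × ℝ, IsIntegralCurve γ (fun _ => X) ∧
      Function.Periodic γ T ∧ range γ = range γ₀ ∧ ℓ (γ 0) = 0 ∧ ∀ w, ∃ t, γ t ≠ w := by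
    refine ⟨fun t => γ₀ (t + t₀), hγ₀.comp_add_right t₀, fun t => ?_, ?_, by simpa using hz,
      fun w => ?_⟩
    · beta_reduce
      rw [add_right_comm, hper₀ (t + t₀)]
    · exact (Equiv.addRight t₀).surjective.range_comp γ₀
    · by_contra! h
      apply ht'
      have h1 := h (t' - t₀)
      have h2 := h (0 - t₀)
      simp only [sub_add_cancel] at h1 h2
      rw [h1, h2]
  rw [← hrange] at hΓU hiso
  clear hrange hz ht' hper₀ hγ₀
  have hcont : Continuous γ := continuous_iff_continuousAt.2 fun t => (hγ t).continuousAt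
  have hcpt : IsCompact (range γ) := hper.compact_of_continuous hT.ne' hcont
  obtain ⟨M, hM⟩ : ∃ M, range γ ⊆ ball 0 M := hcpt.isBounded.subset_ball 0
  obtain ⟨η, hη, hthick⟩ := hcpt.exists_thickening_subset_open (hU.inter isOpen_ball)
    (subset_inter hΓU hM)
  obtain ⟨Y, K, C, hK, hC, hYrev, hYX⟩ := exists_reversible_cutoff hX hRn hRR hrev M
  have hγY : IsIntegralCurve γ (fun _ => Y) := fun t => by
    have := hYX (γ t) (by simpa using hM ⟨t, rfl⟩)
    simpa only [this] using hγ t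
  have hX0 : ∀ t, X (γ t) ≠ 0 := by
    intro t h0
    have hY0 : Y (γ t) = 0 := by rw [hYX (γ t) (by simpa using hM ⟨t, rfl⟩), h0]
    have hcst : IsIntegralCurve (fun _ : ℝ => γ t) (fun _ => Y) := fun s => by
      simpa only [hY0] using hasDerivAt_const s (γ t)
    obtain ⟨s, hs⟩ := hnc (γ t)
    exact hs (congrFun (hγY.eq_of_lipschitzWith hK hcst (t₀ := t) rfl) s)
  -- At an axis point, a field vector along the axis is fixed by `R`, so reversibility makes it its
  -- own negative.
  have htrans : ∀ t, ℓ (γ t) = 0 → ℓ (X (γ t)) ≠ 0 := by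
    intro t h h'
    have h1 := hrev (γ t)
    rw [(hfix _).1 h, (hfix _).1 h'] at h1
    exact hX0 t (self_eq_neg.1 h1)
  have hder : ∀ t, HasDerivAt (fun t => ℓ (γ t)) (ℓ (X (γ t))) t := fun t =>
    ℓ.hasFDerivAt.comp_hasDerivAt t (hγ t)
  have hsymm : ∀ {δ : ℝ → ℝ × ℝ}, IsIntegralCurve δ (fun _ => Y) → ℓ (δ 0) = 0 →
      ∀ t, R (δ (-t)) = δ t := by
    intro δ hδ h0 t
    exact congrFun ((hδ.comp_neg_of_reversible hYrev).eq_of_lipschitzWith hK hδ (t₀ := 0)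
      (by simpa using (hfix _).1 h0)) t
  -- Symmetry and periodicity give `R (γ (T / 2)) = γ (-(T / 2)) = γ (T / 2)`.
  have hhalf : ℓ (γ (T / 2)) = 0 := by
    have h1 := hsymm hγY hℓ0 (-(T / 2))
    have h2 := hper (-(T / 2))
    rw [neg_neg] at h1
    rw [show -(T / 2) + T = T / 2 by ring] at h2
    exact (hfix _).2 (h1.trans h2.symm)
  -- The factor `d` makes the crossing go from negative to positive in either case.
  set d := ℓ (X (γ (T / 2))) with hd_def
  have hd : d ≠ 0 := htrans _ hhalf
  obtain ⟨t₁, ⟨h₁, h₁'⟩, t₂, ⟨h₂, h₂'⟩, hneg, hpos⟩ := exists_sign_change_of_hasDerivAt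
    ((hder (T / 2)).const_mul d) (mul_self_pos.2 hd) (by simp [hhalf]) (half_pos hT)
  have hcℓ : Continuous fun w => d * ℓ w := by fun_prop
  obtain ⟨η₁, hη₁, hb₁⟩ := Metric.isOpen_iff.1 (isOpen_lt hcℓ continuous_const) _ hneg
  obtain ⟨η₂, hη₂, hb₂⟩ := Metric.isOpen_iff.1 (isOpen_lt continuous_const hcℓ) _ hpos
  set m := min η (min η₁ η₂) with hm_def
  have hm : 0 < m := lt_min hη (lt_min hη₁ hη₂)
  -- Grönwall bound on `[0, 2 * T]`: the neighbouring orbit will return to the axis at some `τ < T`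
  -- and have period `2 * τ`.
  set ν := m / 2 / Real.exp (K * (2 * T)) with hν_def
  have hν : 0 < ν := by positivity
  -- Only countably many axis points lie on the orbit, so a starting point arbitrarily close to `γ
  -- 0` can avoid it.
  have hS := (countable_zeros_of_hasDerivAt hder htrans).image γ
  have hinj : Function.Injective fun s : ℝ => γ 0 + s • e := fun s s' h =>
    smul_left_injective ℝ he (add_left_cancel h)
  obtain ⟨s, hs, hs0, hsν⟩ := ((hS.preimage hinj).dense_compl ℝ).exists_between
    (show 0 < ν / ‖e‖ by positivity)
  have hℓz : ℓ (γ 0 + s • e) = 0 := by simp [hℓ0, hℓe]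
  obtain ⟨δ, hδ0, hδ⟩ := exists_isIntegralCurve_of_lipschitzWith_of_bounded hK hC (γ 0 + s • e)
  have hδcont : Continuous δ := continuous_iff_continuousAt.2 fun t => (hδ t).continuousAt
  have hclose : ∀ t ∈ Icc 0 (2 * T), dist (δ t) (γ t) < m := by
    intro t ht
    have hd0 : dist (δ 0) (γ 0) ≤ ν := by
      rw [hδ0, dist_eq_norm, add_sub_cancel_left, norm_smul, Real.norm_of_nonneg hs0.le]
      exact ((lt_div_iff₀ (norm_pos_iff.2 he)).1 hsν).le
    calc dist (δ t) (γ t) ≤ ν * Real.exp (K * (t - 0)) :=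
          dist_le_of_trajectories_ODE (v := fun _ => Y) (fun _ => hK) hδcont.continuousOn
            (fun t _ => (hδ t).hasDerivWithinAt) hcont.continuousOn
            (fun t _ => (hγY t).hasDerivWithinAt) hd0 t ht
      _ ≤ ν * Real.exp (K * (2 * T)) := by
          have := ht.2
          gcongr
          linarith
      _ = m / 2 := div_mul_cancel₀ _ (Real.exp_pos _).ne'
      _ < m := half_lt_self hm
  have hδ₁ : d * ℓ (δ t₁) < 0 := hb₁ ((hclose t₁ ⟨by linarith, by linarith⟩).trans_le
    ((min_le_right _ _).trans (min_le_left _ _)))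
  have hδ₂ : 0 < d * ℓ (δ t₂) := hb₂ ((hclose t₂ ⟨by linarith, by linarith⟩).trans_le
    ((min_le_right _ _).trans (min_le_right _ _)))
  obtain ⟨τ, hτ, hτ0⟩ := intermediate_value_Icc (h₁'.trans h₂).le
    (hcℓ.comp hδcont).continuousOn ⟨hδ₁.le, hδ₂.le⟩
  have hτpos : 0 < τ := by linarith [hτ.1]
  have hℓτ : ℓ (δ τ) = 0 := (mul_eq_zero.1 hτ0).resolve_left hd
  have hback : δ (-τ) = δ τ := by
    have h1 := hsymm hδ (by rw [hδ0, hℓz]) (-τ)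
    rw [neg_neg, (hfix _).1 hℓτ] at h1
    exact h1.symm
  have hδper : Function.Periodic δ (2 * τ) := fun t =>
    congrFun ((hδ.comp_add_right (2 * τ)).eq_of_lipschitzWith hK hδ (t₀ := -τ)
      (by simp only [show -τ + 2 * τ = τ by ring, hback])) t
  have hδU : range δ ⊆ U ∩ ball 0 M := by
    rintro _ ⟨t, rfl⟩
    obtain ⟨y, hy, hty⟩ := hδper.exists_mem_Ico₀ (by linarith) t
    rw [hty]
    exact hthick (mem_thickening_iff.2 ⟨γ y, ⟨y, rfl⟩,
      (hclose y ⟨hy.1, by linarith [hy.2, hτ.2]⟩).trans_le (min_le_left _ _)⟩)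
  have hδX : IsIntegralCurve δ (fun _ => X) := fun t => by
    have := hYX (δ t) (by simpa using (hδU ⟨t, rfl⟩).2)
    simpa only [this] using hδ t
  have hδnc : ∃ t, δ t ≠ δ 0 := by
    by_contra! h
    rw [h t₁] at hδ₁
    rw [h t₂] at hδ₂
    exact lt_asymm hδ₁ hδ₂
  have heq := hiso (range δ) ⟨δ, 2 * τ, by linarith, hδX, hδper, hδnc, rfl⟩
    (hδU.trans inter_subset_left)
  obtain ⟨u, hu⟩ : δ 0 ∈ range γ := heq ▸ ⟨0, rfl⟩
  exact hs ⟨u, by rw [mem_ofPred_eq, hu, hδ0, hℓz], by rw [hu, hδ0]⟩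

/-! ### One-signed functions and periodic solutions of scalar equations -/

/-- A real function which is everywhere nonnegative or everywhere nonpositive. -/
def OneSigned (f : ℝ → ℝ) : Prop :=
  (∀ t, 0 ≤ f t) ∨ ∀ t, f t ≤ 0

theorem OneSigned.const (r : ℝ) : OneSigned fun _ => r :=
  (le_total 0 r).imp (fun h _ => h) fun h _ => h

theorem OneSigned.mul {f g : ℝ → ℝ} (hf : OneSigned f) (hg : OneSigned g) :
    OneSigned fun t => f t * g t := by
  rcases hf with hf | hf <;> rcases hg with hg | hg
  · exact Or.inl fun t => mul_nonneg (hf t) (hg t)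
  · exact Or.inr fun t => mul_nonpos_of_nonneg_of_nonpos (hf t) (hg t)
  · exact Or.inr fun t => mul_nonpos_of_nonpos_of_nonneg (hf t) (hg t)
  · exact Or.inl fun t => mul_nonneg_of_nonpos_of_nonpos (hf t) (hg t)

theorem OneSigned.pow {f : ℝ → ℝ} (hf : OneSigned f) (n : ℕ) : OneSigned fun t => f t ^ n := by
  induction n with
  | zero => simpa using OneSigned.const 1
  | succ n ih => simpa only [pow_succ] using ih.mul hf

theorem OneSigned.even_pow (f : ℝ → ℝ) {n : ℕ} (hn : Even n) : OneSigned fun t => f t ^ n :=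
  Or.inl fun t => hn.pow_nonneg (f t)

theorem OneSigned.of_ne_zero {f : ℝ → ℝ} (hf : Continuous f) (h0 : ∀ t, f t ≠ 0) :
    OneSigned f := by
  by_contra h
  simp only [OneSigned, not_or, not_forall, not_le] at h
  obtain ⟨⟨s, hs⟩, t, ht⟩ := h
  obtain ⟨u, hu⟩ := mem_range_of_exists_le_of_exists_ge hf ⟨s, hs.le⟩ ⟨t, ht.le⟩
  exact h0 u hu

/-- A monotone function taking the same value at all translates of a point by multiples of a
period is constant. -/
theorem Monotone.eq_of_forall_int {f : ℝ → ℝ} (hf : Monotone f) {T t₀ : ℝ} (hT : 0 < T)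
    (h : ∀ n : ℤ, f (t₀ + n * T) = f t₀) (t : ℝ) : f t = f t₀ := by
  obtain ⟨n, hn⟩ := exists_nat_ge (|t - t₀| / T)
  rw [div_le_iff₀ hT] at hn
  have h1 := h n
  have h2 := h (-n)
  push_cast at h1 h2
  apply le_antisymm
  · rw [← h1]
    exact hf (by linarith [le_abs_self (t - t₀)])
  · rw [← h2]
    exact hf (by linarith [neg_abs_le (t - t₀)])

/-- A periodic function whose derivative does not change sign has derivative zero. -/
theorem Function.Periodic.deriv_eq_zero_of_oneSigned {f f' : ℝ → ℝ} {T : ℝ}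
    (hper : Function.Periodic f T) (hT : 0 < T) (hf : ∀ t, HasDerivAt f (f' t) t)
    (h : OneSigned f') (t : ℝ) : f' t = 0 := by
  have main : ∀ {g g' : ℝ → ℝ}, Function.Periodic g T → (∀ t, HasDerivAt g (g' t) t) →
      (∀ t, 0 ≤ g' t) → g' t = 0 := by
    intro g g' hp hg h
    have hconst : g = fun _ => g 0 := funext fun t =>
      (monotone_of_hasDerivAt_nonneg hg h).eq_of_forall_int hT (fun n => hp.int_mul n 0) t
    have hd := hg t
    rw [hconst] at hd
    exact hd.unique (hasDerivAt_const t _)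
  rcases h with h | h
  · exact main hper hf h
  · have hp : Function.Periodic (fun t => -f t) T := fun t => by simp only [hper t]
    exact neg_eq_zero.1 (main hp (fun t => (hf t).neg) fun t => neg_nonneg.2 (h t))

/-- A periodic solution of `y' = B + h y` with one-signed `B` vanishes identically as soon as it
has a zero. -/
theorem Function.Periodic.eq_zero_of_linear {y B h : ℝ → ℝ} {T : ℝ}
    (hper : Function.Periodic y T) (hT : 0 < T) (hh : Continuous h)
    (hy : ∀ t, HasDerivAt y (B t + h t * y t) t) (hB : OneSigned B) {t₀ : ℝ} (h0 : y t₀ = 0)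
    (t : ℝ) : y t = 0 := by
  have main : ∀ {y B : ℝ → ℝ}, Function.Periodic y T → (∀ t, HasDerivAt y (B t + h t * y t) t) →
      (∀ t, 0 ≤ B t) → y t₀ = 0 → y t = 0 := by
    intro y B hper hy hB h0
    have hH : ∀ t, HasDerivAt (fun t => ∫ s in (0 : ℝ)..t, h s) (h t) t := fun t =>
      intervalIntegral.integral_hasDerivAt_right (hh.intervalIntegrable _ _)
        (hh.stronglyMeasurableAtFilter _ _) hh.continuousAt
    -- With the integrating factor the function is monotone, and it vanishes at all `t₀ + n * T`.
    have hw : ∀ t, HasDerivAt (fun t => y t * Real.exp (-∫ s in (0 : ℝ)..t, h s))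
        (B t * Real.exp (-∫ s in (0 : ℝ)..t, h s)) t := fun t =>
      ((hy t).mul (hH t).neg.exp).congr_deriv (by simp only [Pi.neg_apply]; ring)
    have hz := (monotone_of_hasDerivAt_nonneg hw fun t =>
      mul_nonneg (hB t) (Real.exp_pos _).le).eq_of_forall_int hT (t₀ := t₀)
      (fun n => by simp only [hper.int_mul n t₀, h0, zero_mul]) t
    simpa [h0, (Real.exp_pos _).ne'] using hz
  rcases hB with hB | hB
  · exact main hper hy hB h0
  · have hp : Function.Periodic (fun t => -y t) T := fun t => by simp only [hper t]
    exact neg_eq_zero.1 (main (B := fun t => -B t) hp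
      (fun t => (hy t).neg.congr_deriv (by ring)) (fun t => neg_nonneg.2 (hB t)) (by simp [h0]))

/-! ### Constraints on nonconstant periodic solutions of the system -/

/-- The functions `x`, `y` form a solution of `x' = a x^p y^q`, `y' = b x^i y^j + c x^k y^l`
of period `T > 0`. -/
structure IsPeriodicSolution (a b c : ℝ) (p q i j k l : ℕ) (T : ℝ) (x y : ℝ → ℝ) : Prop where
  pos : 0 < T
  hasDerivAt_fst : ∀ t, HasDerivAt x (a * x t ^ p * y t ^ q) t
  hasDerivAt_snd : ∀ t, HasDerivAt y (b * x t ^ i * y t ^ j + c * x t ^ k * y t ^ l) t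
  periodic_fst : Function.Periodic x T
  periodic_snd : Function.Periodic y T

namespace IsPeriodicSolution

variable {a b c T : ℝ} {p q i j k l : ℕ} {x y : ℝ → ℝ}

theorem continuous_fst (h : IsPeriodicSolution a b c p q i j k l T x y) : Continuous x :=
  continuous_iff_continuousAt.2 fun t => (h.hasDerivAt_fst t).continuousAt

theorem continuous_snd (h : IsPeriodicSolution a b c p q i j k l T x y) : Continuous y :=
  continuous_iff_continuousAt.2 fun t => (h.hasDerivAt_snd t).continuousAt

/-- If the first coordinate is stationary, so is the second: it solves a scalar autonomous
equation. -/
theorem eq_of_fst_stationary (h : IsPeriodicSolution a b c p q i j k l T x y)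
    (h0 : ∀ t, a * x t ^ p * y t ^ q = 0) (t : ℝ) : x t = x 0 ∧ y t = y 0 := by
  have hx : ∀ t, x t = x 0 := fun t =>
    is_const_of_deriv_eq_zero (fun t => (h.hasDerivAt_fst t).differentiableAt)
      (fun t => (h.hasDerivAt_fst t).deriv.trans (h0 t)) t 0
  -- With `x` frozen, an antiderivative in `y` of the right-hand side has derivative `y' ^ 2` along
  -- the solution.
  have hF : ∀ t, HasDerivAt (fun t => b * x 0 ^ i * (y t ^ (j + 1) / (j + 1)) +
      c * x 0 ^ k * (y t ^ (l + 1) / (l + 1)))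
      ((b * x t ^ i * y t ^ j + c * x t ^ k * y t ^ l) ^ 2) t := fun t => by
    refine (((((h.hasDerivAt_snd t).pow (j + 1)).div_const ((j : ℝ) + 1)).const_mul _).add
      ((((h.hasDerivAt_snd t).pow (l + 1)).div_const ((l : ℝ) + 1)).const_mul _)).congr_deriv ?_
    have hj : (j : ℝ) + 1 ≠ 0 := by positivity
    have hl : (l : ℝ) + 1 ≠ 0 := by positivity
    simp only [Nat.add_sub_cancel, Nat.cast_add, Nat.cast_one, hx t]
    field_simp
  have hz := Function.Periodic.deriv_eq_zero_of_oneSigned (T := T)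
    (fun t => by simp only [h.periodic_snd t]) h.pos hF (Or.inl fun t => sq_nonneg _)
  exact ⟨hx t, is_const_of_deriv_eq_zero (fun t => (h.hasDerivAt_snd t).differentiableAt)
    (fun t => (h.hasDerivAt_snd t).deriv.trans (pow_eq_zero_iff two_ne_zero |>.1 (hz t))) t 0⟩

theorem eq_of_snd_eq_zero (h : IsPeriodicSolution a b c p q i j k l T x y) (hq : q ≠ 0)
    (h0 : ∀ t, y t = 0) (t : ℝ) : x t = x 0 ∧ y t = y 0 :=
  h.eq_of_fst_stationary (fun t => by simp [h0 t, hq]) t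

/-- If `p ≠ 0`, the first coordinate vanishes identically or nowhere. -/
theorem fst_eq_zero (h : IsPeriodicSolution a b c p q i j k l T x y) (hp : p ≠ 0) {t₀ : ℝ}
    (h0 : x t₀ = 0) (t : ℝ) : x t = 0 := by
  obtain ⟨p, rfl⟩ := Nat.exists_eq_succ_of_ne_zero hp
  have := h.continuous_fst
  have := h.continuous_snd
  exact h.periodic_fst.eq_zero_of_linear h.pos (B := fun _ => 0)
    (h := fun t => a * x t ^ p * y t ^ q) (by fun_prop)
    (fun t => (h.hasDerivAt_fst t).congr_deriv (by rw [pow_succ]; ring)) (OneSigned.const 0) h0 t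

/-- Unless `x` vanishes identically with `p ≠ 0`, the factor `x ^ p` is one-signed, so `x'` is too;
periodicity then gives `x' = 0`. -/
theorem eq_of_oneSigned (h : IsPeriodicSolution a b c p q i j k l T x y)
    (hs : OneSigned fun t => y t ^ q) (t : ℝ) : x t = x 0 ∧ y t = y 0 := by
  have hstat : OneSigned (fun t => x t ^ p) → x t = x 0 ∧ y t = y 0 := fun hxp =>
    h.eq_of_fst_stationary (h.periodic_fst.deriv_eq_zero_of_oneSigned h.pos h.hasDerivAt_fst
      (((OneSigned.const a).mul hxp).mul hs)) t
  by_cases hp : p = 0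
  · exact hstat (by simpa [hp] using OneSigned.const 1)
  by_cases hx : ∃ t₀, x t₀ = 0
  · obtain ⟨t₀, h0⟩ := hx
    exact h.eq_of_fst_stationary (fun t => by simp [h.fst_eq_zero hp h0 t, hp]) t
  · exact hstat ((OneSigned.of_ne_zero h.continuous_fst (not_exists.1 hx)).pow p)

theorem odd_of_ne (h : IsPeriodicSolution a b c p q i j k l T x y)
    (hnc : ∃ t, ¬(x t = x 0 ∧ y t = y 0)) : Odd q := by
  by_contra hq
  obtain ⟨t, ht⟩ := hnc
  exact ht (h.eq_of_oneSigned (OneSigned.even_pow y (Nat.not_odd_iff_even.1 hq)) t)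

theorem exists_snd_eq_zero (h : IsPeriodicSolution a b c p q i j k l T x y)
    (hnc : ∃ t, ¬(x t = x 0 ∧ y t = y 0)) : ∃ t, y t = 0 := by
  by_contra hy
  obtain ⟨t, ht⟩ := hnc
  exact ht (h.eq_of_oneSigned
    ((OneSigned.of_ne_zero h.continuous_snd (not_exists.1 hy)).pow q) t)

/-- A nonconstant periodic solution crosses the `x`-axis, so one of the monomials of the second
component is free of `y`. -/
theorem exponent_eq_zero (h : IsPeriodicSolution a b c p q i j k l T x y)
    (hnc : ∃ t, ¬(x t = x 0 ∧ y t = y 0)) : (b ≠ 0 ∧ j = 0) ∨ (c ≠ 0 ∧ l = 0) := by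
  by_contra! hcon
  have hpred : ∀ (r : ℝ) (n : ℕ), (r ≠ 0 → n ≠ 0) → ∀ s : ℝ, r * s ^ n = r * s ^ (n - 1) * s := by
    intro r n hn s
    by_cases hr : r = 0
    · simp [hr]
    · rw [mul_assoc, ← pow_succ, Nat.sub_add_cancel (Nat.one_le_iff_ne_zero.2 (hn hr))]
  have hcx := h.continuous_fst
  have hcy := h.continuous_snd
  have hq := (h.odd_of_ne hnc).pos.ne'
  obtain ⟨t₀, h0⟩ := h.exists_snd_eq_zero hnc
  obtain ⟨t, ht⟩ := hnc
  refine ht (h.eq_of_snd_eq_zero hq (h.periodic_snd.eq_zero_of_linear h.pos (B := fun _ => 0)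
    (h := fun t => x t ^ i * (b * y t ^ (j - 1)) + x t ^ k * (c * y t ^ (l - 1))) (by fun_prop)
    (fun t => (h.hasDerivAt_snd t).congr_deriv ?_) (OneSigned.const 0) h0) t)
  linear_combination x t ^ i * hpred b j hcon.1 (y t) + x t ^ k * hpred c l hcon.2 (y t)

/-- For `j = 0` and odd `l`, a nonconstant periodic solution meets both sides of the `y`-axis. -/
theorem not_oneSigned_fst_pow (h : IsPeriodicSolution a b c p q i 0 k l T x y) (hl : Odd l)
    (hnc : ∃ t, ¬(x t = x 0 ∧ y t = y 0)) : ¬ OneSigned fun t => x t ^ i := by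
  intro hs
  have hcx := h.continuous_fst
  have hcy := h.continuous_snd
  have hq := (h.odd_of_ne hnc).pos.ne'
  obtain ⟨t₀, h0⟩ := h.exists_snd_eq_zero hnc
  obtain ⟨t, ht⟩ := hnc
  -- Read the equation as `y' = b x^i + (c x^k y^(l-1)) y`, linear in `y` with one-signed forcing.
  refine ht (h.eq_of_snd_eq_zero hq (h.periodic_snd.eq_zero_of_linear h.pos
    (h := fun t => c * x t ^ k * y t ^ (l - 1)) (by fun_prop)
    (fun t => (h.hasDerivAt_snd t).congr_deriv ?_) ((OneSigned.const b).mul hs) h0) t)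
  rw [pow_zero, mul_one, mul_assoc (c * x t ^ k), ← pow_succ, Nat.sub_add_cancel hl.pos]

/-- With odd `q`, `l` and even `k` the energy is monotone along solutions, so the periodic
solutions of `x' = a y^q`, `y' = b x^i + c x^k y^l` are constant. -/
theorem eq_of_energy (h : IsPeriodicSolution a b c 0 q i 0 k l T x y) (hc : c ≠ 0) (hq : Odd q)
    (hl : Odd l) (hk : Even k) (t : ℝ) : x t = x 0 ∧ y t = y 0 := by
  -- This is the Hamiltonian of the system with `c = 0`, so only the `c` term survives in its
  -- derivative.
  have hH : ∀ t, HasDerivAt (fun t => a * (y t ^ (q + 1) / (q + 1)) -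
      b * (x t ^ (i + 1) / (i + 1))) (a * c * x t ^ k * y t ^ (q + l)) t := fun t => by
    refine (((((h.hasDerivAt_snd t).pow (q + 1)).div_const ((q : ℝ) + 1)).const_mul _).sub
      ((((h.hasDerivAt_fst t).pow (i + 1)).div_const ((i : ℝ) + 1)).const_mul _)).congr_deriv ?_
    have hj : (q : ℝ) + 1 ≠ 0 := by positivity
    have hl : (i : ℝ) + 1 ≠ 0 := by positivity
    simp only [Nat.add_sub_cancel, Nat.cast_add, Nat.cast_one]
    field_simp
    ring
  have hz := Function.Periodic.deriv_eq_zero_of_oneSigned (T := T)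
    (fun t => by simp only [h.periodic_snd t, h.periodic_fst t]) h.pos hH
    (((OneSigned.const (a * c)).mul (OneSigned.even_pow x hk)).mul
      (OneSigned.even_pow y (hq.add_odd hl)))
  refine h.eq_of_fst_stationary (fun s => ?_) t
  by_contra hne
  have ha : a ≠ 0 := by
    rintro rfl
    simp at hne
  have hy : y s ≠ 0 := fun h0 => hne (by simp [h0, hq.pos.ne'])
  -- Where `y ≠ 0`, the vanishing energy derivative forces `x = 0`; holding near `s`, this gives `x'
  -- = 0` at `s`.
  have hx : x =ᶠ[nhds s] fun _ => 0 := by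
    filter_upwards [h.continuous_snd.continuousAt.eventually_ne hy] with u hu
    have := hz u
    simp only [mul_eq_zero, ha, hc, pow_eq_zero_iff', hu, false_or, or_false, false_and] at this
    exact this.1
  exact hne ((h.hasDerivAt_fst s).unique ((hasDerivAt_const s (0 : ℝ)).congr_of_eventuallyEq hx))

end IsPeriodicSolution

theorem IsPeriodicOrbit.exists_isPeriodicSolution {a b c : ℝ} {p q i j k l : ℕ} {Γ : Set (ℝ × ℝ)}
    (h : IsPeriodicOrbit
      (fun z => (a * z.1 ^ p * z.2 ^ q, b * z.1 ^ i * z.2 ^ j + c * z.1 ^ k * z.2 ^ l)) Γ) :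
    ∃ (T : ℝ) (x y : ℝ → ℝ), IsPeriodicSolution a b c p q i j k l T x y ∧
      (∃ t, ¬(x t = x 0 ∧ y t = y 0)) ∧ ∀ t, (x t, y t) ∈ Γ := by
  obtain ⟨γ, T, hT, hγ, hper, ⟨t, ht⟩, rfl⟩ := h
  refine ⟨T, fun t => (γ t).1, fun t => (γ t).2, ⟨hT, fun t => ?_, fun t => ?_, fun t => ?_,
    fun t => ?_⟩, ⟨t, fun h => ht (Prod.ext h.1 h.2)⟩, fun t => ⟨t, rfl⟩⟩
  · exact (hγ t).fst
  · exact (hγ t).snd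
  · simp only [hper t]
  · simp only [hper t]

/-! ### The two reflections and the parity case analysis -/

/-- The reflection in the `x`-axis is a reversing symmetry if `j = 0`, `q` is odd, and `l` is even. -/
theorem not_isLimitCycle_of_even {a b c : ℝ} {p q i k l : ℕ} (hq : Odd q) (hl : Even l)
    {Γ : Set (ℝ × ℝ)} (hmeet : ∃ z ∈ Γ, z.2 = 0) :
    ¬ IsLimitCycle
      (fun z => (a * z.1 ^ p * z.2 ^ q, b * z.1 ^ i * z.2 ^ 0 + c * z.1 ^ k * z.2 ^ l)) Γ := by
  refine not_isLimitCycle_of_reversible (by fun_prop)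
    (R := (ContinuousLinearMap.fst ℝ ℝ ℝ).prod (-ContinuousLinearMap.snd ℝ ℝ ℝ))
    (fun z => by simp [Prod.norm_def]) (fun z => by simp) (fun z => ?_)
    (ℓ := ContinuousLinearMap.snd ℝ ℝ ℝ) (fun z => ?_) (e := (1, 0)) (by simp) (by simp) hmeet
  · ext <;> simp [hq.neg_pow, hl.neg_pow]
  · simp [Prod.ext_iff, neg_eq_self]

/-- The reflection in the `y`-axis is a reversing symmetry if `p = j = 0` and `i`, `k` are odd. -/
theorem not_isLimitCycle_of_odd {a b c : ℝ} {q i k l : ℕ} (hi : Odd i) (hk : Odd k)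
    {Γ : Set (ℝ × ℝ)} (hmeet : ∃ z ∈ Γ, z.1 = 0) :
    ¬ IsLimitCycle
      (fun z => (a * z.1 ^ 0 * z.2 ^ q, b * z.1 ^ i * z.2 ^ 0 + c * z.1 ^ k * z.2 ^ l)) Γ := by
  refine not_isLimitCycle_of_reversible (by fun_prop)
    (R := (-ContinuousLinearMap.fst ℝ ℝ ℝ).prod (ContinuousLinearMap.snd ℝ ℝ ℝ))
    (fun z => by simp [Prod.norm_def]) (fun z => by simp) (fun z => ?_)
    (ℓ := ContinuousLinearMap.fst ℝ ℝ ℝ) (fun z => ?_) (e := (0, 1)) (by simp) (by simp) hmeet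
  · ext
    · simp
    · simp [hi.neg_pow, hk.neg_pow]
      ring
  · simp [Prod.ext_iff, neg_eq_self]

theorem not_isLimitCycle_of_exponent_eq_zero {a b c : ℝ} {p q i k l : ℕ} {Γ : Set (ℝ × ℝ)} :
    ¬ IsLimitCycle
      (fun z => (a * z.1 ^ p * z.2 ^ q, b * z.1 ^ i * z.2 ^ 0 + c * z.1 ^ k * z.2 ^ l)) Γ := by
  intro hΓ
  obtain ⟨T, x, y, h, hnc, hmem⟩ := hΓ.1.exists_isPeriodicSolution
  have hq := h.odd_of_ne hnc
  obtain ⟨t₀, hy0⟩ := h.exists_snd_eq_zero hnc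
  by_cases hc : c = 0
  · subst hc
    -- The second monomial is absent, so its exponents may be replaced by the even value `0`.
    exact not_isLimitCycle_of_even (c := 0) (k := 0) (l := 0) hq Even.zero ⟨_, hmem t₀, hy0⟩
      (by simpa using hΓ)
  rcases Nat.even_or_odd l with hl | hl
  · exact not_isLimitCycle_of_even hq hl ⟨_, hmem t₀, hy0⟩ hΓ
  have hs := h.not_oneSigned_fst_pow hl hnc
  have hi : Odd i := Nat.not_even_iff_odd.1 fun hi => hs (OneSigned.even_pow x hi)
  obtain ⟨t₁, hx0⟩ : ∃ t, x t = 0 := by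
    by_contra hx
    exact hs ((OneSigned.of_ne_zero h.continuous_fst (not_exists.1 hx)).pow i)
  -- Otherwise the zero of `x` would spread to all times and `x ^ i` would be one-signed.
  obtain rfl : p = 0 := by
    by_contra hp
    exact hs (by simpa [h.fst_eq_zero hp hx0, hi.pos.ne'] using OneSigned.const 0)
  rcases Nat.even_or_odd k with hk | hk
  · obtain ⟨t, ht⟩ := hnc
    exact ht (h.eq_of_energy hc hq hl hk t)
  · exact not_isLimitCycle_of_odd hi hk ⟨_, hmem t₁, hx0⟩ hΓ

theorem mainTheorem3 (a b c : ℝ) (p q i j k l : ℕ) :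
    ¬ ∃ Γ : Set (ℝ × ℝ),
      IsLimitCycle
        (fun z => (a * z.1 ^ p * z.2 ^ q, b * z.1 ^ i * z.2 ^ j + c * z.1 ^ k * z.2 ^ l)) Γ := by
  rintro ⟨Γ, hΓ⟩
  obtain ⟨T, x, y, h, hnc, -⟩ := hΓ.1.exists_isPeriodicSolution
  rcases h.exponent_eq_zero hnc with ⟨-, rfl⟩ | ⟨-, rfl⟩
  · exact not_isLimitCycle_of_exponent_eq_zero hΓ
  · simp only [add_comm (b * _ * _)] at hΓ
    exact not_isLimitCycle_of_exponent_eq_zero hΓ
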